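/- Let $S$ be a complete hyperbolic surface, i.e. $S=\Gamma\backslash\mathbb H$, where $\mathbb H$ is the upper half-plane with the metric $|dz|/\operatorname{Im} z$ and $\Gamma$ is a group of isometries of $\mathbb H$ acting freely and properly discontinuously. ($S$ need not be orientable or have finite area.) A cusp of $S$ is represented by a point $c\in\mathbb R\cup\{\infty\}$ fixed by a parabolic element of $\Gamma$. A cusp region at $c$ is the image in $S$ of a closed horoball $B$ based at $c$ such that every $\gamma\in\Gamma$ with $\gamma B\cap B\neq\emptyset$ fixes $c$, and such that the horocycle $\partial B$ projects to a simple closed curve in $S$, called the bounding curve of the region. A simple closed geodesic of $S$ is a closed geodesic without self-intersections, i.e. the image in $S$ of a complete geodesic of $\mathbb H$ whose unit speed parametrization is periodic in $S$, and injective in $S$ on one period. **Theorem.** Let $S$ be a complete hyperbolic surface with at least one cusp. Then, at every cusp, $S$ has a cusp region whose bounding curve has length $2$. Moreover, no simple closed geodesic of $S$ meets a cusp region whose bounding curve has length $2$ (the cusp region being taken closed, so that simple closed geodesics do not meet the bounding horocycle either). -/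

import Mathlib

open scoped MatrixGroups

/-- `Γ` uniformizes a hyperbolic surface. `GL(2, ℝ)` acts on the upper half-plane `ℍ` by isometries
(matrices of negative determinant act as orientation-reversing ones), and all isometries of `ℍ`
arise so. The action of `Γ` is required to be properly discontinuous, and free modulo the
matrices acting trivially. The complete hyperbolic surfaces are exactly the quotients `Γ \ ℍ`. -/
structure IsSurfaceGroup (Γ : Subgroup (GL (Fin 2) ℝ)) : Prop where
  properlyDiscontinuous : ProperlyDiscontinuousSMul Γ UpperHalfPlane
  free : ∀ γ ∈ Γ, ∀ z : UpperHalfPlane, γ • z = z → ∀ w : UpperHalfPlane, γ • w = w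

/-- The surface `S = Γ \ ℍ`. -/
abbrev HypSurface (Γ : Subgroup (GL (Fin 2) ℝ)) : Type :=
  MulAction.orbitRel.Quotient Γ UpperHalfPlane

/-- The projection `ℍ → Γ \ ℍ`. -/
noncomputable def surfaceProj (Γ : Subgroup (GL (Fin 2) ℝ)) (z : UpperHalfPlane) : HypSurface Γ :=
  Quotient.mk _ z

/-- The length, for the hyperbolic metric `|dz| / Im z`, of the (smooth) curve `η` restricted to
`[a, b]`. -/
noncomputable def hypLength (η : ℝ → UpperHalfPlane) (a b : ℝ) : ℝ :=
  ∫ x in a..b, ‖deriv (fun s : ℝ => (η s : ℂ)) x‖ / (η x).im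

/-- The closed horoball `g • {Im z ≥ t}`, based at the boundary point `g • ∞`. -/
def horoball (g : SL(2, ℝ)) (t : ℝ) : Set UpperHalfPlane :=
  {z | t ≤ (g⁻¹ • z).im}

/-- The horocycle `g • {Im z = t}` bounding `horoball g t`, parametrized by
`x ↦ g • (x + i t)`. -/
noncomputable def horocycle (g : SL(2, ℝ)) (t : ℝ) (ht : 0 < t) (x : ℝ) : UpperHalfPlane :=
  g • (⟨⟨x, t⟩, ht⟩ : UpperHalfPlane)

/-- `U` is a (closed) cusp region of `S = Γ \ ℍ` at the cusp `c`, with bounding curve of length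
`L`: it is the image of a closed horoball `B` based at `c` such that `B` modulo the stabilizer
of `c` embeds in `S`, and the horocycle bounding `B` projects to a simple closed curve in `S`
whose length (over one period `h`) is `L`. -/
def IsCuspRegion (Γ : Subgroup (GL (Fin 2) ℝ)) (c : OnePoint ℝ) (L : ℝ)
    (U : Set (HypSurface Γ)) : Prop :=
  ∃ (g : SL(2, ℝ)) (t : ℝ) (ht : 0 < t) (h : ℝ),
    (g : GL (Fin 2) ℝ) • (OnePoint.infty : OnePoint ℝ) = c ∧
    U = surfaceProj Γ '' horoball g t ∧
    (∀ γ ∈ Γ, ∀ z ∈ horoball g t, γ • z ∈ horoball g t → γ • c = c) ∧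
    0 < h ∧
    Function.Periodic (fun x => surfaceProj Γ (horocycle g t ht x)) h ∧
    Set.InjOn (fun x => surfaceProj Γ (horocycle g t ht x)) (Set.Ico 0 h) ∧
    hypLength (horocycle g t ht) 0 h = L

/-- `C` is (the image of) a simple closed geodesic of `S = Γ \ ℍ`: the projection of a unit speed
geodesic line `β` of `ℍ` which is periodic in `S`, and injective on a period. -/
def IsSimpleClosedGeodesic (Γ : Subgroup (GL (Fin 2) ℝ)) (C : Set (HypSurface Γ)) : Prop :=
  ∃ (β : ℝ → UpperHalfPlane) (l : ℝ), Isometry β ∧ 0 < l ∧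
    Function.Periodic (fun s => surfaceProj Γ (β s)) l ∧
    Set.InjOn (fun s => surfaceProj Γ (β s)) (Set.Ico 0 l) ∧
    C = Set.range (fun s => surfaceProj Γ (β s))

section

open UpperHalfPlane Matrix Matrix.GeneralLinearGroup

/-! Move the cusp to `∞` by `g` and replace `Γ` by the group `Δ = saturatedConj Γ g` of all matrices
acting on `ℍ` like elements of `g⁻¹ Γ g`. Since `Δ` contains the scalars, a parabolic fixing `∞` has
a unipotent multiple in `Δ`; the real translations in `Δ` form a group `wℤ` with `w > 0`.

Existence: a horoball `Im z ≥ t` has boundary length `w / t`, so `t = w / 2` is wanted. Let `M ∈ Δ`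
move `∞`, with lower left entry `c`. Freeness excludes elliptic elements and reflections. Adjusting
the trace by translations gives `16 det M ≤ (w c)²`, and applying this to a square gives `8 |det M|
≤ (w c)²` for either orientation (`eight_mul_abs_det_le`). If `M` carried a point of the horoball
into it, then `(w c)² ≤ 4 |det M|`, a contradiction.

Disjointness: let a lift of a simple closed geodesic reach height `t`, where `T : z ↦ z + 2t` acts
as an element of `Δ`. A vertical lift is translated upwards inside the horoball by an element which
must fix `∞`, hence preserve heights: impossible. A semicircle of radius `r > t` crosses its image
under `T`, which contradicts simplicity. If `r = t`, the two are asymptotic, which contradicts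
discontinuity (`false_of_semicircle`). -/

/-! ### Isometries of the upper half-plane -/

theorem UpperHalfPlane.dist_coe_gl_smul (g : GL (Fin 2) ℝ) (z w : ℍ) :
    dist ((g • z : ℍ) : ℂ) (g • w : ℍ) =
      |g.det.val| * dist (z : ℂ) w / (‖denom g z‖ * ‖denom g w‖) := by
  have hz := denom_ne_zero g z
  have hw := denom_ne_zero g w
  have key : num g z / denom g z - num g w / denom g w =
      (g.det.val : ℂ) * (z - w) / (denom g z * denom g w) := by
    rw [div_sub_div _ _ hz hw]
    congr 1
    simp only [num, denom, val_det_apply, Matrix.det_fin_two]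
    push_cast
    ring
  rw [coe_smul, coe_smul, dist_eq_norm, ← map_sub, norm_σ, key, norm_div, norm_mul, norm_mul,
    Complex.norm_real, Real.norm_eq_abs, dist_eq_norm]

instance UpperHalfPlane.isIsometricSMul_gl : IsIsometricSMul (GL (Fin 2) ℝ) ℍ := by
  refine ⟨fun g => Isometry.of_dist_eq fun z w => ?_⟩
  have hz := denom_ne_zero g z
  have hw := denom_ne_zero g w
  have hd : |g.det.val| ≠ 0 := abs_ne_zero.mpr g.det.ne_zero
  have h : Real.cosh (dist (g • z) (g • w)) = Real.cosh (dist z w) := by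
    rw [cosh_dist, cosh_dist, dist_coe_gl_smul, im_smul_eq_div_normSq, im_smul_eq_div_normSq,
      Complex.normSq_eq_norm_sq, Complex.normSq_eq_norm_sq]
    have := norm_ne_zero_iff.mpr hz
    have := norm_ne_zero_iff.mpr hw
    have := z.im_ne_zero
    have := w.im_ne_zero
    congr 1
    field_simp
  exact Real.cosh_strictMonoOn.injOn (Set.mem_Ici.2 dist_nonneg) (Set.mem_Ici.2 dist_nonneg) h

theorem UpperHalfPlane.upperRightHom_smul (x : ℝ) (z : ℍ) :
    (upperRightHom x : GL (Fin 2) ℝ) • z = x +ᵥ z := by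
  ext
  rw [coe_smul_of_det_pos (by simp [Matrix.det_fin_two])]
  simp [num, denom, add_comm]

/-! ### Saturated surface groups -/

/-- The group contains every matrix acting as one of its elements, and acts on `ℍ` discontinuously,
and freely modulo the matrices acting trivially. -/
structure IsSaturatedSurfaceGroup (Δ : Subgroup (GL (Fin 2) ℝ)) : Prop where
  discontinuous : ∀ K L : Set ℍ, IsCompact K → IsCompact L →
    ∃ F : Set (GL (Fin 2) ℝ), F.Finite ∧
      ∀ M ∈ Δ, ∀ z ∈ K, M • z ∈ L → ∃ N ∈ F, N ∈ Δ ∧ ∀ w : ℍ, M • w = N • w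
  free : ∀ M ∈ Δ, ∀ z : ℍ, M • z = z → ∀ w : ℍ, M • w = w
  saturated : ∀ M ∈ Δ, ∀ N : GL (Fin 2) ℝ, (∀ w : ℍ, M • w = N • w) → N ∈ Δ

/-- The matrices whose conjugate by `g` acts on `ℍ` as an element of `Γ`. -/
noncomputable def saturatedConj (Γ : Subgroup (GL (Fin 2) ℝ)) (g : GL (Fin 2) ℝ) :
    Subgroup (GL (Fin 2) ℝ) :=
  ((Γ.map (MulAction.toPermHom (GL (Fin 2) ℝ) ℍ)).comap
    (MulAction.toPermHom (GL (Fin 2) ℝ) ℍ)).comap (MulAut.conj g).toMonoidHom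

theorem mem_saturatedConj {Γ : Subgroup (GL (Fin 2) ℝ)} {g M : GL (Fin 2) ℝ} :
    M ∈ saturatedConj Γ g ↔ ∃ γ ∈ Γ, ∀ z : ℍ, γ • g • z = g • M • z := by
  simp only [saturatedConj, Subgroup.mem_comap, Subgroup.mem_map, MulEquiv.coe_toMonoidHom,
    MulAut.conj_apply, DFunLike.ext_iff, MulAction.toPermHom_apply, MulAction.toPerm_apply]
  refine exists_congr fun γ => and_congr_right fun _ => ⟨fun h z => ?_, fun h z => ?_⟩
  · rw [h]; simp [mul_smul]
  · have := h (g⁻¹ • z)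
    simpa [mul_smul] using this

theorem conj_mem_saturatedConj {Γ : Subgroup (GL (Fin 2) ℝ)} (g : GL (Fin 2) ℝ)
    {γ : GL (Fin 2) ℝ} (hγ : γ ∈ Γ) : g⁻¹ * γ * g ∈ saturatedConj Γ g :=
  mem_saturatedConj.2 ⟨γ, hγ, fun z => by simp [mul_smul]⟩

theorem IsSurfaceGroup.isSaturatedSurfaceGroup {Γ : Subgroup (GL (Fin 2) ℝ)}
    (hΓ : IsSurfaceGroup Γ) (g : GL (Fin 2) ℝ) :
    IsSaturatedSurfaceGroup (saturatedConj Γ g) where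
  discontinuous K L hK hL := by
    have hcont : Continuous fun z : ℍ => g • z := continuous_const_smul g
    have hfin := hΓ.properlyDiscontinuous.finite_disjoint_inter_image
      (hK.image hcont) (hL.image hcont)
    refine ⟨(fun γ : Γ => g⁻¹ * (γ : GL (Fin 2) ℝ) * g) '' _, hfin.image _, ?_⟩
    intro M hM z hz hMz
    obtain ⟨γ, hγ, h⟩ := mem_saturatedConj.1 hM
    refine ⟨g⁻¹ * γ * g, ⟨⟨γ, hγ⟩, ⟨γ • g • z, ⟨g • z, ⟨z, hz, rfl⟩, rfl⟩, M • z, hMz, ?_⟩, rfl⟩,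
      conj_mem_saturatedConj g hγ, fun w => ?_⟩
    · exact (h z).symm
    · rw [mul_smul, mul_smul, h w, inv_smul_smul]
  free M hM z hz w := by
    obtain ⟨γ, hγ, h⟩ := mem_saturatedConj.1 hM
    have := hΓ.free γ hγ (g • z) (by rw [h, hz]) (g • w)
    rw [h] at this
    exact smul_left_cancel g this
  saturated M hM N hMN := by
    obtain ⟨γ, hγ, h⟩ := mem_saturatedConj.1 hM
    exact mem_saturatedConj.2 ⟨γ, hγ, fun z => by rw [h, hMN]⟩

namespace IsSaturatedSurfaceGroup

variable {Δ : Subgroup (GL (Fin 2) ℝ)}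

theorem mem_center (hΔ : IsSaturatedSurfaceGroup Δ) {M : GL (Fin 2) ℝ} (hM : M ∈ Δ) {z : ℍ}
    (hz : M • z = z) : M ∈ Subgroup.center (GL (Fin 2) ℝ) :=
  forall_smul_eq_self_iff_mem_center.1 (hΔ.free M hM z hz)

theorem exists_isolated (hΔ : IsSaturatedSurfaceGroup Δ) (z : ℍ) :
    ∃ ε > 0, ∀ M ∈ Δ, dist (M • z) z < ε → M • z = z := by
  obtain ⟨F, hF, h⟩ := hΔ.discontinuous {z} (Metric.closedBall z 1) isCompact_singleton
    (isCompact_closedBall z 1)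
  have hA : (((fun N : GL (Fin 2) ℝ => N • z) '' F) \ {z}).Finite := (hF.image _).sdiff
  have hnhds : (((fun N : GL (Fin 2) ℝ => N • z) '' F) \ {z})ᶜ ∈ nhds z :=
    hA.isClosed.isOpen_compl.mem_nhds (by simp)
  obtain ⟨ε, hε, hsub⟩ := Metric.mem_nhds_iff.1 hnhds
  -- The bound `1` keeps `M • z` in the closed ball for which `F` represents all actions.
  refine ⟨min ε 1, lt_min hε one_pos, fun M hM hd => ?_⟩
  obtain ⟨N, hN, -, hMN⟩ := h M hM z rfl (Metric.mem_closedBall.2 (hd.le.trans (min_le_right _ _)))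
  by_contra hne
  exact hsub (Metric.mem_ball.2 (hd.trans_le (min_le_left _ _))) ⟨⟨N, hN, (hMN z).symm⟩, hne⟩

end IsSaturatedSurfaceGroup

/-! ### The stabilizer of `∞` -/

theorem Matrix.GeneralLinearGroup.diag_ne_zero_of_upperTriangular {M : GL (Fin 2) ℝ}
    (h : M 1 0 = 0) : M 0 0 ≠ 0 ∧ M 1 1 ≠ 0 := by
  have := M.det_ne_zero
  rw [Matrix.det_fin_two, h, mul_zero, sub_zero] at this
  exact mul_ne_zero_iff.1 this

theorem UpperHalfPlane.smul_eq_vadd_of_upperTriangular {M : GL (Fin 2) ℝ} (h : M 1 0 = 0)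
    (hd : M 0 0 = M 1 1) (z : ℍ) : M • z = (M 0 1 / M 1 1) +ᵥ z := by
  have h1 := (diag_ne_zero_of_upperTriangular h).2
  have h1' : ((M 1 1 : ℝ) : ℂ) ≠ 0 := by exact_mod_cast h1
  ext
  rw [coe_smul_of_det_pos]
  · simp only [num, denom, h, hd, coe_vadd]
    push_cast
    rw [zero_mul, zero_add]
    field_simp
    ring
  · rw [val_det_apply, Matrix.det_fin_two, h, hd, mul_zero, sub_zero]
    exact mul_self_pos.2 h1

theorem Matrix.GeneralLinearGroup.apply_of_mem_center {M : GL (Fin 2) ℝ}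
    (h : M ∈ Subgroup.center (GL (Fin 2) ℝ)) : M 1 0 = 0 ∧ M 0 1 = 0 ∧ M 0 0 = M 1 1 := by
  rw [GeneralLinearGroup.mem_center_iff_val_mem_range_scalar] at h
  obtain ⟨a, ha⟩ := h
  simp [← ha]

namespace IsSaturatedSurfaceGroup

variable {Δ : Subgroup (GL (Fin 2) ℝ)}

theorem isolated_strictPeriods (hΔ : IsSaturatedSurfaceGroup Δ) :
    ∃ ε > 0, ∀ x ∈ Δ.strictPeriods, |x| < ε → x = 0 := by
  obtain ⟨ε, hε, h⟩ := hΔ.exists_isolated I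
  refine ⟨ε, hε, fun x hx hxε => ?_⟩
  have h1 := h _ (Subgroup.mem_strictPeriods_iff.1 hx) (by
    rw [upperRightHom_smul]
    refine (dist_le_dist_coe_div_sqrt _ _).trans_lt ?_
    simpa [dist_eq_norm] using hxε)
  rw [upperRightHom_smul] at h1
  have := congrArg UpperHalfPlane.re h1
  simpa using this

theorem exists_strictPeriods_eq_zmultiples (hΔ : IsSaturatedSurfaceGroup Δ) {x : ℝ}
    (hx : x ∈ Δ.strictPeriods) (hx0 : x ≠ 0) :
    ∃ w > 0, Δ.strictPeriods = AddSubgroup.zmultiples w := by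
  obtain ⟨ε, hε, h⟩ := hΔ.isolated_strictPeriods
  obtain ⟨b, hb⟩ := AddSubgroup.cyclic_of_isolated_zero (H := Δ.strictPeriods) hε (by
    rw [Set.disjoint_left]
    intro y hy hy'
    exact hy'.1.ne' (h y hy (by rw [abs_of_pos hy'.1]; exact hy'.2)))
  rw [← AddSubgroup.zmultiples_eq_closure] at hb
  have hb0 : b ≠ 0 := by
    rintro rfl
    rw [hb] at hx
    simp at hx
    exact hx0 hx
  rcases hb0.lt_or_gt with hlt | hgt
  · exact ⟨-b, neg_pos.2 hlt, by rw [hb, AddSubgroup.zmultiples_neg]⟩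
  · exact ⟨b, hgt, hb⟩

theorem mul_mem_strictPeriods {M : GL (Fin 2) ℝ} (hM : M ∈ Δ)
    (h : M 1 0 = 0) {x : ℝ} (hx : x ∈ Δ.strictPeriods) :
    x * (M 0 0 / M 1 1) ∈ Δ.strictPeriods := by
  rw [Subgroup.mem_strictPeriods_iff] at hx ⊢
  have h1 := (diag_ne_zero_of_upperTriangular h).2
  have : upperRightHom (x * (M 0 0 / M 1 1)) = M * upperRightHom x * M⁻¹ := by
    rw [eq_mul_inv_iff_mul_eq]
    ext i j
    fin_cases i <;> fin_cases j <;> simp [Matrix.mul_apply, Fin.sum_univ_two, h]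
    field_simp
    ring
  rw [this]
  exact mul_mem (mul_mem hM hx) (inv_mem hM)

/-- Conjugation by `M` and by `M⁻¹` scales the periods `wℤ` by `M 0 0 / M 1 1` and by its
reciprocal. Both are therefore integers, so the ratio is `±1`; ratio `-1` gives a reflection, which
has fixed points in `ℍ`. -/
theorem diag_eq_of_upperTriangular (hΔ : IsSaturatedSurfaceGroup Δ) {w : ℝ} (hw : 0 < w)
    (hper : Δ.strictPeriods = AddSubgroup.zmultiples w) {M : GL (Fin 2) ℝ} (hM : M ∈ Δ)
    (h : M 1 0 = 0) : M 0 0 = M 1 1 := by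
  obtain ⟨h0, h1⟩ := diag_ne_zero_of_upperTriangular h
  have hwmem : w ∈ Δ.strictPeriods := hper ▸ AddSubgroup.mem_zmultiples w
  obtain ⟨n, hn⟩ := AddSubgroup.mem_zmultiples_iff.1 (hper ▸ mul_mem_strictPeriods hM h hwmem)
  have hinv : M⁻¹ 1 0 = 0 ∧ M⁻¹ 0 0 / M⁻¹ 1 1 = M 1 1 / M 0 0 := by
    have hdet := M.det_ne_zero
    rw [Matrix.det_fin_two, h, mul_zero, sub_zero] at hdet
    constructor
    · rw [Matrix.coe_units_inv, Matrix.inv_def, Matrix.adjugate_fin_two]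
      simp [h]
    · rw [Matrix.coe_units_inv, Matrix.inv_def, Matrix.adjugate_fin_two]
      simp [Matrix.det_fin_two, h]
      field_simp
  obtain ⟨m, hm⟩ := AddSubgroup.mem_zmultiples_iff.1
    (hper ▸ mul_mem_strictPeriods (inv_mem hM) hinv.1 hwmem)
  rw [hinv.2] at hm
  simp only [zsmul_eq_mul] at hn hm
  have hn' : (n : ℝ) = M 0 0 / M 1 1 := by
    apply mul_right_cancel₀ hw.ne'; rw [hn]; ring
  have hm' : (m : ℝ) = M 1 1 / M 0 0 := by
    apply mul_right_cancel₀ hw.ne'; rw [hm]; ring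
  have hnm : n * m = 1 := by
    have : (n : ℝ) * m = 1 := by rw [hn', hm']; field_simp
    exact_mod_cast this
  rcases Int.eq_one_or_neg_one_of_mul_eq_one hnm with rfl | rfl
  · rw [eq_comm, Int.cast_one, div_eq_one_iff_eq h1] at hn'
    exact hn'
  · exfalso
    have hneg : M 0 0 = -M 1 1 := by
      rw [eq_div_iff h1] at hn'
      push_cast at hn'
      linarith
    obtain ⟨z, hz⟩ := (exists_gl_smul_eq_self_iff_trace_eq_zero (g := M) (by
      rw [Matrix.det_fin_two, h, hneg]
      nlinarith [mul_self_pos.2 h1])).2 (by rw [Matrix.trace_fin_two, hneg]; ring)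
    have := (apply_of_mem_center (hΔ.mem_center hM hz)).2.2
    exact h1 (by linarith)

theorem exists_smul_eq_zsmul_vadd (hΔ : IsSaturatedSurfaceGroup Δ) {w : ℝ} (hw : 0 < w)
    (hper : Δ.strictPeriods = AddSubgroup.zmultiples w) {M : GL (Fin 2) ℝ} (hM : M ∈ Δ)
    (h : M 1 0 = 0) : ∃ n : ℤ, ∀ z : ℍ, M • z = (n * w : ℝ) +ᵥ z := by
  have hact := smul_eq_vadd_of_upperTriangular h (hΔ.diag_eq_of_upperTriangular hw hper hM h)
  have : M 0 1 / M 1 1 ∈ Δ.strictPeriods := by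
    rw [Subgroup.mem_strictPeriods_iff]
    exact hΔ.saturated M hM _ fun z => by rw [hact, upperRightHom_smul]
  obtain ⟨n, hn⟩ := AddSubgroup.mem_zmultiples_iff.1 (hper ▸ this)
  refine ⟨n, fun z => ?_⟩
  rw [hact, ← hn, zsmul_eq_mul]

/-- Vanishing discriminant forces equal diagonal entries, so `P` acts as a translation, nontrivial
because `P` is not scalar. -/
theorem exists_width_of_isParabolic (hΔ : IsSaturatedSurfaceGroup Δ) {P : GL (Fin 2) ℝ}
    (hP : P ∈ Δ) (hpar : P.IsParabolic) (h : P 1 0 = 0) :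
    ∃ w > 0, Δ.strictPeriods = AddSubgroup.zmultiples w := by
  have hdisc := hpar.2
  rw [Matrix.discr_fin_two, Matrix.trace_fin_two, Matrix.det_fin_two, h] at hdisc
  have hd : P 0 0 = P 1 1 := by
    have : (P 0 0 - P 1 1) ^ 2 = 0 := by linear_combination hdisc
    exact sub_eq_zero.1 (pow_eq_zero_iff two_ne_zero |>.1 this)
  have h1 := (diag_ne_zero_of_upperTriangular h).2
  refine hΔ.exists_strictPeriods_eq_zmultiples (x := P 0 1 / P 1 1) ?_ ?_
  · rw [Subgroup.mem_strictPeriods_iff]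
    exact hΔ.saturated P hP _ fun z => by
      rw [smul_eq_vadd_of_upperTriangular h hd, upperRightHom_smul]
  · refine div_ne_zero (fun hb => hpar.1 ⟨P 1 1, ?_⟩) h1
    ext i j
    fin_cases i <;> fin_cases j <;> simp [h, hd, hb]

/-! ### Trace inequalities for elements moving `∞` -/

theorem four_mul_det_le_trace_sq (hΔ : IsSaturatedSurfaceGroup Δ) {M : GL (Fin 2) ℝ} (hM : M ∈ Δ)
    (h : M 1 0 ≠ 0) : 4 * M.val.det ≤ (M 0 0 + M 1 1) ^ 2 := by
  by_contra! hlt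
  have hdet : 0 < M.val.det := by nlinarith [sq_nonneg (M 0 0 + M 1 1)]
  have hell : M.IsElliptic := by
    change M.val.discr < 0
    rw [Matrix.discr_fin_two, Matrix.trace_fin_two]
    linarith
  exact h (apply_of_mem_center (hΔ.mem_center hM
    ((gl_smul_eq_self_iff_eq_fixedPt hdet hell).2 rfl))).1

theorem trace_ne_zero_of_det_neg (hΔ : IsSaturatedSurfaceGroup Δ) {M : GL (Fin 2) ℝ} (hM : M ∈ Δ)
    (h : M 1 0 ≠ 0) (hdet : M.val.det < 0) : M 0 0 + M 1 1 ≠ 0 := by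
  intro htr
  obtain ⟨z, hz⟩ := (exists_gl_smul_eq_self_iff_trace_eq_zero hdet).2
    (by rw [Matrix.trace_fin_two, htr])
  exact h (apply_of_mem_center (hΔ.mem_center hM hz)).1

/-- Multiplying by a power of a translation of length `w` makes the trace at most half of
`w |M 1 0|`. -/
theorem exists_trace_sq_le {w : ℝ} (hw : w ∈ Δ.strictPeriods) (hw0 : 0 < w)
    {M : GL (Fin 2) ℝ} (hM : M ∈ Δ) (h : M 1 0 ≠ 0) :
    ∃ N ∈ Δ, N 1 0 = M 1 0 ∧ N.val.det = M.val.det ∧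
      4 * (N 0 0 + N 1 1) ^ 2 ≤ (w * M 1 0) ^ 2 := by
  set q := w * M 1 0 with hq
  have hq0 : q ≠ 0 := mul_ne_zero hw0.ne' h
  -- Left multiplication by the `n`-th translation adds `n q` to the trace; this `n` brings it
  -- nearest to `0`.
  set n : ℤ := round (-(M 0 0 + M 1 1) / q) with hn
  have hmem : upperRightHom (n * w : ℝ) ∈ Δ := by
    rw [← Subgroup.mem_strictPeriods_iff, ← zsmul_eq_mul]
    exact zsmul_mem hw n
  refine ⟨upperRightHom (n * w : ℝ) * M, mul_mem hmem hM, ?_, ?_, ?_⟩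
  · simp [Matrix.mul_apply, Fin.sum_univ_two]
  · rw [Units.val_mul, Matrix.det_mul, Matrix.det_fin_two (upperRightHom _).val]
    simp
  · have e : (upperRightHom (n * w : ℝ) * M) 0 0 + (upperRightHom (n * w : ℝ) * M) 1 1 =
        (M 0 0 + M 1 1) + n * q := by
      simp [Matrix.mul_apply, Fin.sum_univ_two, hq]
      ring
    rw [e]
    have hr := abs_sub_round (-(M 0 0 + M 1 1) / q)
    rw [← hn] at hr
    have : M 0 0 + M 1 1 + n * q = -((-(M 0 0 + M 1 1) / q - n) * q) := by field_simp; ring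
    rw [this, neg_sq, mul_pow]
    have hs : (-(M 0 0 + M 1 1) / q - n) ^ 2 ≤ (1 / 2) ^ 2 := sq_le_sq.2 (by
      rwa [abs_of_pos (by norm_num : (0 : ℝ) < 1 / 2)])
    nlinarith [sq_nonneg q]

theorem sixteen_mul_det_le (hΔ : IsSaturatedSurfaceGroup Δ) {w : ℝ} (hw : w ∈ Δ.strictPeriods)
    (hw0 : 0 < w) {M : GL (Fin 2) ℝ} (hM : M ∈ Δ) (h : M 1 0 ≠ 0) :
    16 * M.val.det ≤ (w * M 1 0) ^ 2 := by
  obtain ⟨N, hN, hc, hdet, htr⟩ := exists_trace_sq_le hw hw0 hM h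
  have := hΔ.four_mul_det_le_trace_sq hN (hc ▸ h)
  linarith

/-- If `det M < 0`, take `N` with the same `c` and determinant and with `4 (tr N)² ≤ (w c)²`. The
square `N * N` has positive determinant and lower left entry `c tr N ≠ 0`, so `16 det² ≤ (w c)² (tr
N)² ≤ (w c)⁴ / 4`. -/
theorem eight_mul_abs_det_le (hΔ : IsSaturatedSurfaceGroup Δ) {w : ℝ} (hw : w ∈ Δ.strictPeriods)
    (hw0 : 0 < w) {M : GL (Fin 2) ℝ} (hM : M ∈ Δ) (h : M 1 0 ≠ 0) :
    8 * |M.val.det| ≤ (w * M 1 0) ^ 2 := by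
  rcases M.det_ne_zero.lt_or_gt with hneg | hpos
  · obtain ⟨N, hN, hc, hdet, htr⟩ := exists_trace_sq_le hw hw0 hM h
    have htr0 := hΔ.trace_ne_zero_of_det_neg hN (hc ▸ h) (hdet ▸ hneg)
    have hsq : (N * N) 1 0 = M 1 0 * (N 0 0 + N 1 1) := by
      simp [Matrix.mul_apply, Fin.sum_univ_two, ← hc]
      ring
    have h16 := hΔ.sixteen_mul_det_le hw hw0 (mul_mem hN hN)
      (by rw [hsq]; exact mul_ne_zero h htr0)
    rw [hsq, Units.val_mul, Matrix.det_mul, hdet] at h16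
    rw [abs_of_neg hneg]
    refine abs_le_of_sq_le_sq' ?_ (sq_nonneg _) |>.2
    nlinarith [sq_nonneg (w * M 1 0)]
  · rw [abs_of_pos hpos]
    linarith [hΔ.sixteen_mul_det_le hw hw0 hM h]

/-- The horoball whose bounding curve has length `2` is precisely invariant. -/
theorem lower_left_eq_zero_of_im_le (hΔ : IsSaturatedSurfaceGroup Δ) {w : ℝ}
    (hw : w ∈ Δ.strictPeriods) (hw0 : 0 < w) {M : GL (Fin 2) ℝ} (hM : M ∈ Δ) {z : ℍ}
    (hz : w / 2 ≤ z.im) (hMz : w / 2 ≤ (M • z).im) : M 1 0 = 0 := by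
  by_contra h
  have h8 := hΔ.eight_mul_abs_det_le hw hw0 hM h
  rw [im_smul_eq_div_normSq, val_det_apply] at hMz
  have hpos := normSq_denom_pos M z.im_ne_zero
  rw [le_div_iff₀ hpos] at hMz
  have h1 := c_mul_im_sq_le_normSq_denom M z
  have hdet : 0 < |M.val.det| := abs_pos.2 M.det_ne_zero
  have h2 : w / 2 * (M 1 0 * z.im) ^ 2 ≤ |M.val.det| * z.im :=
    (mul_le_mul_of_nonneg_left h1 (by positivity)).trans hMz
  have h3 : w / 2 * z.im * M 1 0 ^ 2 ≤ |M.val.det| := by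
    refine le_of_mul_le_mul_right ?_ z.im_pos
    linarith
  have h4 : w / 2 * (w / 2) * M 1 0 ^ 2 ≤ |M.val.det| := by
    refine le_trans ?_ h3
    gcongr
  -- `h4` says `(w c)² ≤ 4 |det M|`, against the factor `8` in `h8`.
  nlinarith

end IsSaturatedSurfaceGroup

/-! ### Horoballs and cusp regions in the surface -/

theorem UpperHalfPlane.sl_smul_eq_gl_smul (g : SL(2, ℝ)) (z : ℍ) :
    g • z = (g : GL (Fin 2) ℝ) • z := rfl

theorem exists_sl_smul_infty_eq (c : OnePoint ℝ) :
    ∃ g : SL(2, ℝ), (g : GL (Fin 2) ℝ) • (OnePoint.infty : OnePoint ℝ) = c :=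
  OnePoint.exists_mem_SL2 ℝ c

theorem surfaceProj_eq_iff {Γ : Subgroup (GL (Fin 2) ℝ)} {z w : ℍ} :
    surfaceProj Γ z = surfaceProj Γ w ↔ ∃ γ ∈ Γ, γ • w = z := by
  rw [surfaceProj, surfaceProj, Quotient.eq, MulAction.orbitRel_apply, MulAction.mem_orbit_iff]
  exact ⟨fun ⟨γ, h⟩ => ⟨γ, γ.2, h⟩, fun ⟨γ, hγ, h⟩ => ⟨⟨γ, hγ⟩, h⟩⟩

theorem surfaceProj_smul_eq_iff {Γ : Subgroup (GL (Fin 2) ℝ)} {g : GL (Fin 2) ℝ} {z w : ℍ} :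
    surfaceProj Γ (g • z) = surfaceProj Γ (g • w) ↔ ∃ M ∈ saturatedConj Γ g, M • w = z := by
  rw [surfaceProj_eq_iff]
  constructor
  · rintro ⟨γ, hγ, h⟩
    refine ⟨_, conj_mem_saturatedConj g hγ, ?_⟩
    rw [mul_smul, mul_smul, h, inv_smul_smul]
  · rintro ⟨M, hM, h⟩
    obtain ⟨γ, hγ, hγM⟩ := mem_saturatedConj.1 hM
    exact ⟨γ, hγ, by rw [hγM, h]⟩

theorem smul_smul_infty_eq_iff {g γ : GL (Fin 2) ℝ} :
    γ • g • (OnePoint.infty : OnePoint ℝ) = g • OnePoint.infty ↔ (g⁻¹ * γ * g) 1 0 = 0 := by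
  rw [← OnePoint.smul_infty_eq_self_iff, mul_smul, mul_smul, inv_smul_eq_iff]

theorem IsCusp.exists_width {Γ : Subgroup (GL (Fin 2) ℝ)} (hΓ : IsSurfaceGroup Γ)
    {g : GL (Fin 2) ℝ} (hc : IsCusp (g • (OnePoint.infty : OnePoint ℝ)) Γ) :
    ∃ w > 0, (saturatedConj Γ g).strictPeriods = AddSubgroup.zmultiples w := by
  obtain ⟨P, hP, hpar, hfix⟩ := hc
  refine (hΓ.isSaturatedSurfaceGroup g).exists_width_of_isParabolic (conj_mem_saturatedConj g hP)
    ?_ (smul_smul_infty_eq_iff.1 hfix)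
  have := (Matrix.isParabolic_conj'_iff (g := g) (m := P.val)).2 hpar
  simpa using this

theorem mem_horoball_smul {g : SL(2, ℝ)} {t : ℝ} {z : ℍ} :
    (g : GL (Fin 2) ℝ) • z ∈ horoball g t ↔ t ≤ z.im := by
  rw [horoball, Set.mem_ofPred_eq, ← sl_smul_eq_gl_smul, inv_smul_smul]

theorem horocycle_eq (g : SL(2, ℝ)) (t : ℝ) (ht : 0 < t) (x : ℝ) :
    horocycle g t ht x = (g : GL (Fin 2) ℝ) • (⟨⟨x, t⟩, ht⟩ : ℍ) := rfl

theorem hypLength_horocycle (g : SL(2, ℝ)) (t : ℝ) (ht : 0 < t) (h : ℝ) :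
    hypLength (horocycle g t ht) 0 h = h / t := by
  have key (x : ℝ) : ‖deriv (fun s : ℝ => (horocycle g t ht s : ℂ)) x‖ / (horocycle g t ht x).im
      = 1 / t := by
    set z : ℍ := ⟨⟨x, t⟩, ht⟩ with hz
    have hden : denom (g : GL (Fin 2) ℝ) z ≠ 0 := denom_ne_zero _ _
    have hfun : (fun s : ℝ => (horocycle g t ht s : ℂ)) = fun s : ℝ =>
        ((g 0 0 : ℂ) * (s + t * Complex.I) + g 0 1) / ((g 1 0 : ℂ) * (s + t * Complex.I) + g 1 1) := by
      funext s
      rw [horocycle, coe_specialLinearGroup_apply]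
      simp [Complex.mk_eq_add_mul_I]
    have hzc : (z : ℂ) = x + t * Complex.I := by simp [hz, Complex.mk_eq_add_mul_I]
    have hden' : (g 1 0 : ℂ) * (x + t * Complex.I) + g 1 1 ≠ 0 := by
      rw [← hzc]; exact hden
    have hdet : (g 0 0 : ℂ) * g 1 1 - g 0 1 * g 1 0 = 1 := by
      have := g.det_coe
      rw [Matrix.det_fin_two] at this
      exact_mod_cast this
    have hlin : HasDerivAt (fun s : ℝ => (s : ℂ) + t * Complex.I) 1 x :=
      (Complex.ofRealCLM.hasDerivAt (x := x)).add_const _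
    have hder := ((hlin.const_mul (g 0 0 : ℂ)).add_const (g 0 1 : ℂ)).div
      ((hlin.const_mul (g 1 0 : ℂ)).add_const (g 1 1 : ℂ)) hden'
    have hder' : deriv (fun s : ℝ => (horocycle g t ht s : ℂ)) x =
        1 / (denom (g : GL (Fin 2) ℝ) z) ^ 2 := by
      rw [hfun]
      refine hder.deriv.trans ?_
      change _ = 1 / ((g 1 0 : ℂ) * z + g 1 1) ^ 2
      rw [hzc]
      congr 1
      linear_combination hdet
    have him : (horocycle g t ht x).im = t / ‖denom (g : GL (Fin 2) ℝ) z‖ ^ 2 := by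
      rw [horocycle_eq, im_smul_eq_div_normSq, Complex.normSq_eq_norm_sq]
      simp [hz]
    -- The factor `‖denom‖²` cancels between the speed and the height.
    rw [hder', him, norm_div, norm_pow, norm_one]
    have := norm_ne_zero_iff.2 hden
    field_simp
  rw [hypLength]
  simp_rw [key]
  simp [div_eq_mul_inv]

theorem exists_isCuspRegion_two {Γ : Subgroup (GL (Fin 2) ℝ)} (hΓ : IsSurfaceGroup Γ)
    {c : OnePoint ℝ} (hc : IsCusp c Γ) : ∃ U : Set (HypSurface Γ), IsCuspRegion Γ c 2 U := by
  obtain ⟨g, rfl⟩ := exists_sl_smul_infty_eq c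
  obtain ⟨w, hw, hper⟩ := hc.exists_width hΓ
  have hΔ := hΓ.isSaturatedSurfaceGroup (g : GL (Fin 2) ℝ)
  have hwmem : w ∈ (saturatedConj Γ (g : GL (Fin 2) ℝ)).strictPeriods :=
    hper ▸ AddSubgroup.mem_zmultiples w
  have ht : 0 < w / 2 := half_pos hw
  refine ⟨_, g, w / 2, ht, w, rfl, rfl, ?_, hw, ?_, ?_, ?_⟩
  · intro γ hγ z hz hγz
    rw [smul_smul_infty_eq_iff]
    refine hΔ.lower_left_eq_zero_of_im_le hwmem hw (conj_mem_saturatedConj _ hγ)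
      (z := (g : GL (Fin 2) ℝ)⁻¹ • z) ?_ ?_
    · rwa [← mem_horoball_smul, smul_inv_smul]
    · rw [← mem_horoball_smul (g := g)]
      simpa [mul_smul] using hγz
  · intro x
    simp only [horocycle_eq]
    rw [surfaceProj_smul_eq_iff]
    refine ⟨_, Subgroup.mem_strictPeriods_iff.1 hwmem, ?_⟩
    rw [upperRightHom_smul]
    ext
    simp [Complex.mk_eq_add_mul_I]
    ring
  · intro x hx y hy hxy
    simp only [horocycle_eq] at hxy
    rw [surfaceProj_smul_eq_iff] at hxy
    obtain ⟨M, hM, hMxy⟩ := hxy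
    have h10 := hΔ.lower_left_eq_zero_of_im_le hwmem hw hM
      (z := ⟨⟨y, w / 2⟩, ht⟩) le_rfl (by rw [hMxy]; exact le_rfl)
    obtain ⟨n, hn⟩ := hΔ.exists_smul_eq_zsmul_vadd hw hper hM h10
    rw [hn] at hMxy
    have hre : n * w + y = x := by simpa using congrArg UpperHalfPlane.re hMxy
    have h1 : (n : ℝ) * w < 1 * w := by linarith [hx.2, hy.1]
    have h2 : (-1 : ℝ) * w < n * w := by linarith [hx.1, hy.2]
    have h1' : (n : ℝ) < 1 := lt_of_mul_lt_mul_right h1 hw.le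
    have h2' : (-1 : ℝ) < n := lt_of_mul_lt_mul_right h2 hw.le
    have : n = 0 := by
      have a : n < 1 := by exact_mod_cast h1'
      have b : -1 < n := by exact_mod_cast h2'
      omega
    rw [← hre, this]
    simp
  · rw [hypLength_horocycle]
    field_simp

/-! ### Classification of unit speed geodesic lines -/

namespace UpperHalfPlane

/-- The unit speed parametrization of the vertical geodesic with end point `x`. -/
noncomputable def verticalGeodesic (x s : ℝ) : ℍ := ⟨⟨x, Real.exp s⟩, Real.exp_pos s⟩

/-- The unit speed parametrization of the geodesic with end points `x - r` and `x + r`. -/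
noncomputable def semicircle (x r : ℝ) (hr : 0 < r) (s : ℝ) : ℍ :=
  ⟨⟨x + r * Real.sinh s / Real.cosh s, r / Real.cosh s⟩, div_pos hr (Real.cosh_pos s)⟩

variable {x r : ℝ} {hr : 0 < r} {s : ℝ}

@[simp] theorem verticalGeodesic_re : (verticalGeodesic x s).re = x := rfl

@[simp] theorem verticalGeodesic_im : (verticalGeodesic x s).im = Real.exp s := rfl

@[simp] theorem semicircle_re :
    (semicircle x r hr s).re = x + r * Real.sinh s / Real.cosh s := rfl

@[simp] theorem semicircle_im : (semicircle x r hr s).im = r / Real.cosh s := rfl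

theorem cosh_dist_verticalGeodesic (z : ℍ) :
    Real.cosh (dist z (verticalGeodesic x s)) =
      ((z.re - x) ^ 2 + z.im ^ 2 + Real.exp s ^ 2) / (2 * z.im * Real.exp s) := by
  rw [cosh_dist', verticalGeodesic_re, verticalGeodesic_im]

theorem cosh_dist_semicircle (z : ℍ) :
    Real.cosh (dist z (semicircle x r hr s)) =
      ((z.re - x) ^ 2 + z.im ^ 2 + r ^ 2) / (2 * r * z.im) * Real.cosh s -
        (z.re - x) / z.im * Real.sinh s := by
  rw [cosh_dist', semicircle_re, semicircle_im]
  have h1 := (Real.cosh_pos s).ne'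
  have h2 := z.im_ne_zero
  field_simp
  linear_combination (-r ^ 2) * Real.cosh_sq s

theorem dist_eq_abs_of_cosh_eq {z w : ℍ} {a : ℝ} (h : Real.cosh (dist z w) = Real.cosh a) :
    dist z w = |a| := by
  rw [← Real.cosh_abs a] at h
  exact Real.cosh_strictMonoOn.injOn (Set.mem_Ici.2 dist_nonneg) (Set.mem_Ici.2 (abs_nonneg _)) h

theorem dist_verticalGeodesic (u v : ℝ) :
    dist (verticalGeodesic x u) (verticalGeodesic x v) = |u - v| := by
  rw [dist_of_re_eq (by simp)]
  simp [Real.dist_eq]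

theorem dist_semicircle (u v : ℝ) :
    dist (semicircle x r hr u) (semicircle x r hr v) = |u - v| := by
  apply dist_eq_abs_of_cosh_eq
  rw [cosh_dist_semicircle, Real.cosh_sub, semicircle_re, semicircle_im]
  have h1 := (Real.cosh_pos u).ne'
  field_simp
  linear_combination (-r ^ 2 * Real.cosh v) * Real.cosh_sq u

theorem eq_verticalGeodesic {z : ℍ} {p q : ℝ} (hpq : p ≠ q)
    (hp : dist z (verticalGeodesic x p) = |s - p|) (hq : dist z (verticalGeodesic x q) = |s - q|) :
    z = verticalGeodesic x s := by
  have hy := z.im_ne_zero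
  have key {a : ℝ} (h : dist z (verticalGeodesic x a) = |s - a|) :
      (z.re - x) ^ 2 + z.im ^ 2 + Real.exp a ^ 2 =
        z.im * (Real.exp s + Real.exp a ^ 2 * Real.exp (-s)) := by
    have h1 := congrArg Real.cosh h
    rw [cosh_dist_verticalGeodesic, Real.cosh_abs, Real.cosh_eq, neg_sub,
      Real.exp_sub, Real.exp_sub, div_eq_iff (by positivity)] at h1
    rw [h1, Real.exp_neg]
    have := (Real.exp_pos a).ne'
    have := (Real.exp_pos s).ne'
    field_simp
  have h1 := key hp
  have h2 := key hq
  have hne : Real.exp p ^ 2 - Real.exp q ^ 2 ≠ 0 := by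
    rw [sub_ne_zero]
    intro h
    exact hpq (Real.exp_injective ((sq_eq_sq₀ (Real.exp_pos p).le (Real.exp_pos q).le).1 h))
  have h3 : z.im * Real.exp (-s) = 1 := by
    apply mul_left_cancel₀ hne
    linear_combination h2 - h1
  have him : z.im = Real.exp s := by
    rw [Real.exp_neg] at h3
    field_simp at h3
    exact h3
  have hre : z.re = x := by
    have : (z.re - x) ^ 2 = 0 := by
      linear_combination h1 + Real.exp p ^ 2 * h3 - z.im * him
    exact sub_eq_zero.1 ((pow_eq_zero_iff two_ne_zero).1 this)
  exact UpperHalfPlane.ext_re_im hre him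

/-- By `cosh_dist_semicircle` the two distances give linear equations in `P` and `Q` with
determinant `sinh (p - q) ≠ 0`, whose solution is `P = cosh s`, `Q = sinh s`. -/
theorem eq_semicircle {z : ℍ} {p q : ℝ} (hpq : p ≠ q)
    (hp : dist z (semicircle x r hr p) = |s - p|) (hq : dist z (semicircle x r hr q) = |s - q|) :
    z = semicircle x r hr s := by
  have hy := z.im_ne_zero
  have hc := (Real.cosh_pos s).ne'
  have h1 := congrArg Real.cosh hp
  have h2 := congrArg Real.cosh hq
  rw [cosh_dist_semicircle, Real.cosh_abs, Real.cosh_sub] at h1 h2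
  set P := ((z.re - x) ^ 2 + z.im ^ 2 + r ^ 2) / (2 * r * z.im) with hP
  set Q := (z.re - x) / z.im with hQ
  have hne : Real.sinh (p - q) ≠ 0 := by
    rw [Ne, Real.sinh_eq_zero, sub_eq_zero]
    exact hpq
  rw [Real.sinh_sub] at hne
  have hP' : P = Real.cosh s := by
    apply mul_left_cancel₀ hne
    linear_combination Real.sinh p * h2 - Real.sinh q * h1
  have hQ' : Q = Real.sinh s := by
    apply mul_left_cancel₀ hne
    linear_combination Real.cosh p * h2 - Real.cosh q * h1
  have hX : z.re - x = z.im * Real.sinh s := by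
    rw [← hQ', hQ]
    field_simp
  have hS : (z.re - x) ^ 2 + z.im ^ 2 + r ^ 2 = Real.cosh s * (2 * r * z.im) := by
    rw [← hP', hP]
    field_simp
  have him : z.im * Real.cosh s = r := by
    have : (z.im * Real.cosh s - r) ^ 2 = 0 := by
      rw [hX] at hS
      linear_combination hS + z.im ^ 2 * Real.cosh_sq s
    exact sub_eq_zero.1 ((pow_eq_zero_iff two_ne_zero).1 this)
  refine UpperHalfPlane.ext_re_im ?_ ?_
  · rw [semicircle_re, ← him]
    field_simp
    linarith
  · rw [semicircle_im, ← him]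
    field_simp

theorem exists_eq_semicircle {z : ℍ} (h : (z.re - x) ^ 2 + z.im ^ 2 = r ^ 2) :
    ∃ u, z = semicircle x r hr u := by
  have hy := z.im_ne_zero
  set u := Real.arsinh ((z.re - x) / z.im) with hu
  have hs : Real.sinh u = (z.re - x) / z.im := Real.sinh_arsinh _
  have hc : Real.cosh u = r / z.im := by
    rw [← sq_eq_sq₀ (Real.cosh_pos u).le (div_pos hr z.im_pos).le, Real.cosh_sq, hs]
    field_simp
    linarith
  refine ⟨u, UpperHalfPlane.ext_re_im ?_ ?_⟩
  · rw [semicircle_re, hs, hc]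
    field_simp
    ring
  · rw [semicircle_im, hc]
    field_simp

/-- A unit speed geodesic line is a vertical line or a semicircle. -/
theorem _root_.Isometry.eq_verticalGeodesic_or_semicircle {β : ℝ → ℍ} (hβ : Isometry β) :
    (∃ x ε u : ℝ, (ε = 1 ∨ ε = -1) ∧ ∀ s, β s = verticalGeodesic x (ε * s + u)) ∨
    (∃ (x r : ℝ) (hr : 0 < r) (ε u : ℝ), (ε = 1 ∨ ε = -1) ∧
      ∀ s, β s = semicircle x r hr (ε * s + u)) := by
  have h01 : dist (β 1) (β 0) = 1 := by rw [hβ.dist_eq]; simp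
  have hdist (s a : ℝ) : dist (β s) (β a) = |s - a| := by rw [hβ.dist_eq, Real.dist_eq]
  have habs {ε : ℝ} (hε : ε = 1 ∨ ε = -1) (a : ℝ) : |ε * a| = |a| := by
    rcases hε with rfl | rfl <;> simp
  by_cases hre : (β 1).re = (β 0).re
  · left
    have e (z : ℍ) : z = verticalGeodesic z.re (Real.log z.im) :=
      UpperHalfPlane.ext_re_im rfl (by rw [verticalGeodesic_im, Real.exp_log z.im_pos])
    set u := Real.log (β 0).im with hu
    set v := Real.log (β 1).im with hv
    have e0 : β 0 = verticalGeodesic (β 0).re u := e _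
    have e1 : β 1 = verticalGeodesic (β 0).re v := hre ▸ e (β 1)
    have hvu : |v - u| = 1 := by
      rw [← dist_verticalGeodesic (x := (β 0).re), ← e0, ← e1, h01]
    have hε := eq_or_eq_neg_of_abs_eq hvu
    refine ⟨(β 0).re, v - u, u, hε, fun s => ?_⟩
    refine eq_verticalGeodesic (p := u) (q := v) ?_ ?_ ?_
    · rintro h
      simp [h] at hvu
    · rw [← e0, hdist, add_sub_cancel_right, habs hε, sub_zero]
    · rw [← e1, hdist, ← habs hε]
      congr 1
      ring
  · right
    -- The real point at equal Euclidean distance from `β 0` and `β 1`.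
    set x := ((β 1).re ^ 2 + (β 1).im ^ 2 - (β 0).re ^ 2 - (β 0).im ^ 2) /
      (2 * ((β 1).re - (β 0).re)) with hx
    set r := √(((β 0).re - x) ^ 2 + (β 0).im ^ 2) with hrdef
    have hpos : 0 < ((β 0).re - x) ^ 2 + (β 0).im ^ 2 := by
      have := (β 0).im_pos
      positivity
    have hr : 0 < r := Real.sqrt_pos.2 hpos
    have hr2 : r ^ 2 = ((β 0).re - x) ^ 2 + (β 0).im ^ 2 := Real.sq_sqrt hpos.le
    have hne : (β 1).re - (β 0).re ≠ 0 := sub_ne_zero.2 hre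
    have hx' : x * (2 * ((β 1).re - (β 0).re)) =
        (β 1).re ^ 2 + (β 1).im ^ 2 - (β 0).re ^ 2 - (β 0).im ^ 2 := by
      rw [hx]
      field_simp
    obtain ⟨u, e0⟩ := exists_eq_semicircle (x := x) (hr := hr) hr2.symm
    obtain ⟨v, e1⟩ := exists_eq_semicircle (z := β 1) (x := x) (hr := hr) (by
      rw [hr2]
      linear_combination -hx')
    have hvu : |v - u| = 1 := by
      rw [← dist_semicircle (x := x) (hr := hr), ← e0, ← e1, h01]
    have hε := eq_or_eq_neg_of_abs_eq hvu
    refine ⟨x, r, hr, v - u, u, hε, fun s => ?_⟩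
    refine eq_semicircle (p := u) (q := v) ?_ ?_ ?_
    · rintro h
      simp [h] at hvu
    · rw [← e0, hdist, add_sub_cancel_right, habs hε, sub_zero]
    · rw [← e1, hdist, ← habs hε]
      congr 1
      ring

theorem _root_.Isometry.eq_of_dist_eq_abs {β : ℝ → ℍ} (hβ : Isometry β) {z : ℍ} {p q : ℝ}
    (hpq : p ≠ q) (hp : dist z (β p) = |s - p|) (hq : dist z (β q) = |s - q|) : z = β s := by
  have habs {ε : ℝ} (hε : ε = 1 ∨ ε = -1) (a b u : ℝ) :
      |ε * a + u - (ε * b + u)| = |a - b| := by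
    rw [add_sub_add_right_eq_sub, ← mul_sub]
    rcases hε with rfl | rfl
    · rw [one_mul]
    · rw [neg_one_mul, abs_neg]
  have hinj {ε : ℝ} (hε : ε = 1 ∨ ε = -1) (u : ℝ) : ε * p + u ≠ ε * q + u := by
    rw [← sub_ne_zero, ← abs_ne_zero, habs hε, abs_ne_zero, sub_ne_zero]
    exact hpq
  rcases hβ.eq_verticalGeodesic_or_semicircle with ⟨x, ε, u, hε, h⟩ | ⟨x, r, hr, ε, u, hε, h⟩
  · rw [h] at hp hq ⊢
    exact eq_verticalGeodesic (hinj hε u) (by rw [hp, habs hε]) (by rw [hq, habs hε])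
  · rw [h] at hp hq ⊢
    exact eq_semicircle (hinj hε u) (by rw [hp, habs hε]) (by rw [hq, habs hε])

theorem _root_.Isometry.eq_of_eq_of_eq {β β' : ℝ → ℍ} (hβ : Isometry β) (hβ' : Isometry β')
    {p q : ℝ} (hpq : p ≠ q) (hp : β p = β' p) (hq : β q = β' q) : β = β' := by
  funext s
  refine hβ'.eq_of_dist_eq_abs hpq ?_ ?_
  · rw [← hp, hβ.dist_eq, Real.dist_eq]
  · rw [← hq, hβ.dist_eq, Real.dist_eq]

end UpperHalfPlane

/-! ### Closed geodesics and horoballs at `∞` -/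

namespace IsSaturatedSurfaceGroup

variable {Δ : Subgroup (GL (Fin 2) ℝ)}

/-- A geodesic line which is periodic in the quotient is translated by an element of the group. -/
theorem exists_smul_eq_add (hΔ : IsSaturatedSurfaceGroup Δ) {β : ℝ → ℍ} (hβ : Isometry β) {l : ℝ}
    (h : ∀ s, ∃ M ∈ Δ, M • β s = β (s + l)) : ∃ M ∈ Δ, ∀ s, M • β s = β (s + l) := by
  choose M hM hMs using h
  obtain ⟨F, hF, hFM⟩ := hΔ.discontinuous (β '' Set.Icc 0 1) (β '' Set.Icc l (1 + l))
    (isCompact_Icc.image hβ.continuous) (isCompact_Icc.image hβ.continuous)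
  have hex (s : Set.Icc (0 : ℝ) 1) : ∃ N ∈ F, N ∈ Δ ∧ ∀ w : ℍ, M s • w = N • w := by
    refine hFM (M s) (hM s) (β s) ⟨s, s.2, rfl⟩ ⟨s + l, ⟨?_, ?_⟩, (hMs s).symm⟩
    · linarith [s.2.1]
    · linarith [s.2.2]
  choose N hNF hNΔ hN using hex
  have hinf : (Set.univ : Set (Set.Icc (0 : ℝ) 1)).Infinite :=
    Set.infinite_univ_iff.2 (Set.Icc_infinite one_pos).to_subtype
  -- Pigeonhole: infinitely many parameters, finitely many actions. One element then works at two
  -- parameters, hence along the whole line.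
  obtain ⟨p, -, q, -, hpq, hNpq⟩ :=
    hinf.exists_ne_map_eq_of_mapsTo (f := N) (fun s _ => hNF s) hF
  refine ⟨N p, hNΔ p, fun s => ?_⟩
  have h1 : Isometry fun s => N p • β s := (isometry_smul ℍ (N p)).comp hβ
  have h2 : Isometry fun s => β (s + l) := hβ.comp (Isometry.of_dist_eq fun a b => by simp)
  exact congrFun (h1.eq_of_eq_of_eq h2 (Subtype.coe_ne_coe.2 hpq)
    (by rw [← hN, hMs]) (by rw [hNpq, ← hN, hMs])) s

theorem exists_smul_eq_add_zsmul {β : ℝ → ℍ} {l : ℝ}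
    (h : ∃ M ∈ Δ, ∀ s, M • β s = β (s + l)) (k : ℤ) :
    ∃ M ∈ Δ, ∀ s, M • β s = β (s + k * l) := by
  obtain ⟨M, hM, hMs⟩ := h
  refine ⟨M ^ k, zpow_mem hM k, ?_⟩
  induction k using Int.induction_on with
  | zero => simp
  | succ k ih =>
    intro s
    rw [_root_.zpow_add_one, mul_smul, hMs, ih]
    congr 1
    push_cast
    ring
  | pred k ih =>
    intro s
    have : M⁻¹ • β s = β (s - l) := by
      rw [inv_smul_eq_iff, hMs, sub_add_cancel]
    rw [_root_.zpow_sub_one, mul_smul, this, ih]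
    congr 1
    push_cast
    ring

/-- A semicircle of radius `r ≥ t` is not the lift of a simple closed geodesic if the group contains
the translation by `2 * t`. -/
theorem false_of_semicircle (hΔ : IsSaturatedSurfaceGroup Δ) {x r t l : ℝ} {hr : 0 < r}
    (ht : 0 < t) (htr : t ≤ r) (hT : 2 * t ∈ Δ.strictPeriods) (hl : 0 < l)
    (hper : ∀ k : ℤ, ∃ M ∈ Δ, ∀ s, M • semicircle x r hr s = semicircle x r hr (s + k * l))
    (hinj : ∀ s s', (∃ M ∈ Δ, M • semicircle x r hr s' = semicircle x r hr s) →
      ∃ k : ℤ, s - s' = k * l) : False := by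
  have hT' := Subgroup.mem_strictPeriods_iff.1 hT
  rcases htr.eq_or_lt with rfl | hlt
  · obtain ⟨ε, hε, h⟩ := hΔ.exists_isolated (semicircle x t hr 0)
    have hlim : Filter.Tendsto (fun n : ℕ => 2 * Real.exp (-(n * l))) Filter.atTop (nhds 0) := by
      have : Filter.Tendsto (fun n : ℕ => (n : ℝ) * l) Filter.atTop Filter.atTop :=
        tendsto_natCast_atTop_atTop.atTop_mul_const hl
      simpa using (Real.tendsto_exp_neg_atTop_nhds_zero.comp this).const_mul 2
    obtain ⟨n, hn⟩ := (hlim.eventually (gt_mem_nhds hε)).exists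
    obtain ⟨M, hM, hMs⟩ := hper (-(n : ℤ))
    set a : ℝ := n * l with ha
    have hc := (Real.cosh_pos a).ne'
    have hM0 : M • semicircle x t hr 0 = semicircle x t hr (-a) := by
      rw [hMs, ha]; congr 1; push_cast; ring
    have hMa : semicircle x t hr 0 = M • semicircle x t hr a := by
      rw [hMs, ha]; congr 1; push_cast; ring
    have hd : dist ((2 * t : ℝ) +ᵥ semicircle x t hr (-a)) (semicircle x t hr a) ≤
        2 * Real.exp (-a) := by
      refine (dist_le_dist_coe_div_sqrt _ _).trans ?_
      have him : ((2 * t : ℝ) +ᵥ semicircle x t hr (-a)).im = t / Real.cosh a := by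
        simp
      rw [him, semicircle_im, Real.sqrt_mul_self (div_pos hr (Real.cosh_pos a)).le,
        Complex.dist_of_im_eq (by rw [coe_im, coe_im, him, semicircle_im]), coe_re, coe_re,
        vadd_re, semicircle_re, semicircle_re, Real.sinh_neg, Real.cosh_neg, Real.dist_eq]
      have e : 2 * t + (x + t * -Real.sinh a / Real.cosh a) -
          (x + t * Real.sinh a / Real.cosh a) = 2 * Real.exp (-a) * (t / Real.cosh a) := by
        rw [← Real.cosh_sub_sinh]
        field_simp
        ring
      have hpos : 0 < t / Real.cosh a := div_pos hr (Real.cosh_pos a)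
      rw [e, abs_of_pos (by positivity), mul_div_assoc, div_self hpos.ne', mul_one]
    -- `M` shifts the semicircle by `-a`: it takes the top to parameter `-a`, the translation brings
    -- that point within `2 exp (-a)` of parameter `a`, and `M` takes parameter `a` back to the top.
    have hfix := h (M * upperRightHom (2 * t) * M) (mul_mem (mul_mem hM hT') hM) (by
      rw [mul_smul, mul_smul, hM0, upperRightHom_smul]
      conv_lhs => rw [hMa]
      rw [dist_smul]
      exact hd.trans_lt hn)
    rw [mul_smul, mul_smul, hM0, upperRightHom_smul] at hfix
    conv_rhs at hfix => rw [hMa]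
    have hre := congrArg UpperHalfPlane.re (smul_left_cancel M hfix)
    rw [vadd_re, semicircle_re, semicircle_re, Real.sinh_neg, Real.cosh_neg] at hre
    field_simp at hre
    have hexp := Real.exp_pos (-a)
    rw [← Real.cosh_sub_sinh] at hexp
    nlinarith
  · have hmem : t / r ∈ Set.Ioo (-1 : ℝ) 1 :=
      ⟨by linarith [div_pos ht hr], (div_lt_one hr).2 hlt⟩
    -- The semicircle and its translate by `2 * t` cross above `x + t`, at parameter `a` of the
    -- former and `-a` of the latter.
    set a := Real.artanh (t / r) with ha
    have ha0 : 0 < a := Real.artanh_pos ⟨div_pos ht hr, hmem.2⟩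
    have htanh : Real.sinh a = t / r * Real.cosh a := by
      rw [← Real.tanh_artanh hmem, ← ha, Real.tanh_eq_sinh_div_cosh]
      have := (Real.cosh_pos a).ne'
      field_simp
    have hTa : upperRightHom (2 * t) • semicircle x r hr (-a) = semicircle x r hr a := by
      rw [upperRightHom_smul]
      refine UpperHalfPlane.ext_re_im ?_ ?_
      · rw [vadd_re, semicircle_re, semicircle_re, Real.sinh_neg, Real.cosh_neg, htanh]
        have := (Real.cosh_pos a).ne'
        field_simp
        ring
      · rw [vadd_im, semicircle_im, semicircle_im, Real.cosh_neg]
    obtain ⟨k, hk⟩ := hinj a (-a) ⟨_, hT', hTa⟩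
    obtain ⟨M, hM, hMs⟩ := hper k
    have hMa : M • semicircle x r hr (-a) = semicircle x r hr a := by
      rw [hMs, ← hk]; congr 1; ring
    -- The shift `M` along the semicircle and the translation agree at one point, hence everywhere;
    -- but `M` lowers the top.
    have hfree := hΔ.free (M⁻¹ * upperRightHom (2 * t)) (mul_mem (inv_mem hM) hT')
      (semicircle x r hr (-a)) (by rw [mul_smul, hTa, inv_smul_eq_iff, hMa])
      (semicircle x r hr 0)
    rw [mul_smul, inv_smul_eq_iff, hMs, upperRightHom_smul] at hfree
    have him := congrArg UpperHalfPlane.im hfree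
    rw [vadd_im, semicircle_im, semicircle_im, Real.cosh_zero, zero_add, ← hk] at him
    have h1 : 1 < Real.cosh (a - -a) := Real.one_lt_cosh.2 (by linarith)
    have h2 : r / Real.cosh (a - -a) < r := div_lt_self hr h1
    linarith

/-- The lifts of a simple closed geodesic stay below the horoball whose bounding curve has
length `2`. -/
theorem im_lt_of_simple (hΔ : IsSaturatedSurfaceGroup Δ) {w : ℝ} (hw : 0 < w)
    (hwper : Δ.strictPeriods = AddSubgroup.zmultiples w) {t : ℝ} (ht : 0 < t)
    (hT : 2 * t ∈ Δ.strictPeriods)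
    (hstab : ∀ M ∈ Δ, ∀ z : ℍ, t ≤ z.im → t ≤ (M • z).im → M 1 0 = 0)
    {β : ℝ → ℍ} (hβ : Isometry β) {l : ℝ} (hl : 0 < l)
    (hper : ∀ s, ∃ M ∈ Δ, M • β s = β (s + l))
    (hinj : ∀ s s', (∃ M ∈ Δ, M • β s' = β s) → ∃ k : ℤ, s - s' = k * l) (s : ℝ) :
    (β s).im < t := by
  by_contra! hts
  have hk := exists_smul_eq_add_zsmul (hΔ.exists_smul_eq_add hβ hper)
  have hint {ε : ℝ} (hε : ε = 1 ∨ ε = -1) : ∃ e : ℤ, (e : ℝ) = ε ∧ e * e = 1 := by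
    rcases hε with rfl | rfl
    · exact ⟨1, by simp, by norm_num⟩
    · exact ⟨-1, by simp, by norm_num⟩
  rcases hβ.eq_verticalGeodesic_or_semicircle with ⟨x, ε, u, hε, h⟩ | ⟨x, r, hr, ε, u, hε, h⟩
  · obtain ⟨e, rfl, he⟩ := hint hε
    have heR : (e : ℝ) * e = 1 := by exact_mod_cast he
    -- The sign `e` makes the shift go upwards whichever way `β` runs.
    obtain ⟨M, hM, hMs⟩ := hk e
    have him : (M • β s).im = Real.exp ((e * s + u) + l) := by
      rw [hMs, h, verticalGeodesic_im]
      congr 1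
      linear_combination l * heR
    have hlt : (β s).im < (M • β s).im := by
      rw [him, h, verticalGeodesic_im]
      exact Real.exp_lt_exp.2 (by linarith)
    obtain ⟨n, hn⟩ := hΔ.exists_smul_eq_zsmul_vadd hw hwper hM
      (hstab M hM (β s) hts (hts.trans hlt.le))
    rw [hn, vadd_im] at hlt
    exact lt_irrefl _ hlt
  · obtain ⟨e, rfl, he⟩ := hint hε
    have heR : (e : ℝ) * e = 1 := by exact_mod_cast he
    have hσ (a : ℝ) : semicircle x r hr a = β (e * (a - u)) := by
      rw [h]
      congr 1
      linear_combination (u - a) * heR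
    refine hΔ.false_of_semicircle (x := x) (hr := hr) ht (hts.trans ?_) hT hl (fun k => ?_) ?_
    · rw [h, semicircle_im]
      exact div_le_self hr.le (Real.one_le_cosh _)
    · obtain ⟨M, hM, hMs⟩ := hk (e * k)
      refine ⟨M, hM, fun a => ?_⟩
      rw [hσ, hσ, hMs]
      congr 1
      push_cast
      ring
    · rintro a b ⟨M, hM, hMs⟩
      rw [hσ, hσ] at hMs
      obtain ⟨k, hk⟩ := hinj _ _ ⟨M, hM, hMs⟩
      refine ⟨e * k, ?_⟩
      push_cast
      linear_combination e * hk + (b - a) * heR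

end IsSaturatedSurfaceGroup

/-! ### Return to the surface -/

theorem Function.Periodic.exists_sub_eq_zsmul {α : Type*} {f : ℝ → α} {l : ℝ}
    (hf : Function.Periodic f l) (hl : 0 < l) (hinj : Set.InjOn f (Set.Ico 0 l)) {s s' : ℝ}
    (h : f s = f s') : ∃ k : ℤ, s - s' = k * l := by
  have hmod (a : ℝ) : f (toIcoMod hl 0 a) = f a := by
    rw [toIcoMod]
    exact hf.sub_zsmul_eq _
  have hmem (a : ℝ) : toIcoMod hl 0 a ∈ Set.Ico 0 l := by
    simpa using toIcoMod_mem_Ico hl 0 a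
  have heq := hinj (hmem s) (hmem s') (by rw [hmod, hmod, h])
  refine ⟨toIcoDiv hl 0 s - toIcoDiv hl 0 s', ?_⟩
  have h1 := toIcoMod_add_toIcoDiv_zsmul hl 0 s
  have h2 := toIcoMod_add_toIcoDiv_zsmul hl 0 s'
  simp only [zsmul_eq_mul] at h1 h2
  push_cast
  linarith

theorem IsSimpleClosedGeodesic.inter_eq_empty {Γ : Subgroup (GL (Fin 2) ℝ)}
    (hΓ : IsSurfaceGroup Γ) {c : OnePoint ℝ} (hc : IsCusp c Γ) {U C : Set (HypSurface Γ)}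
    (hU : IsCuspRegion Γ c 2 U) (hC : IsSimpleClosedGeodesic Γ C) : C ∩ U = ∅ := by
  obtain ⟨g, t, ht, h, rfl, rfl, hstab, hh, hhper, -, hlen⟩ := hU
  obtain ⟨β, l, hβ, hl, hβper, hβinj, rfl⟩ := hC
  obtain ⟨w, hw, hwper⟩ := hc.exists_width hΓ
  have hΔ := hΓ.isSaturatedSurfaceGroup (g : GL (Fin 2) ℝ)
  rw [hypLength_horocycle, div_eq_iff ht.ne'] at hlen
  have hstab' : ∀ M ∈ saturatedConj Γ (g : GL (Fin 2) ℝ), ∀ z : ℍ, t ≤ z.im →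
      t ≤ (M • z).im → M 1 0 = 0 := by
    intro M hM z hz hMz
    obtain ⟨γ, hγ, hγM⟩ := mem_saturatedConj.1 hM
    have hfix := hstab γ hγ _ (mem_horoball_smul.2 hz) (by rw [hγM]; exact mem_horoball_smul.2 hMz)
    rw [smul_smul_infty_eq_iff] at hfix
    obtain ⟨n, hn⟩ := hΔ.exists_smul_eq_zsmul_vadd hw hwper (conj_mem_saturatedConj _ hγ) hfix
    have hact (v : ℍ) : M • v = (upperRightHom (n * w : ℝ) : GL (Fin 2) ℝ) • v := by
      rw [upperRightHom_smul, ← hn, mul_smul, mul_smul, hγM, inv_smul_smul]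
    -- `M` need not be the conjugate of `γ`, but it acts like it, so it is a scalar times a
    -- unipotent matrix.
    have hcent : (upperRightHom (n * w : ℝ))⁻¹ * M ∈ Subgroup.center (GL (Fin 2) ℝ) :=
      forall_smul_eq_self_iff_mem_center.1 fun v => by rw [mul_smul, hact, inv_smul_smul]
    have hM' : M = upperRightHom (n * w : ℝ) * ((upperRightHom (n * w : ℝ))⁻¹ * M) := by group
    have h10 := (apply_of_mem_center hcent).1
    rw [hM']
    generalize (upperRightHom (n * w : ℝ))⁻¹ * M = N at h10
    simp [Matrix.mul_apply, Fin.sum_univ_two, h10]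
  have hT : 2 * t ∈ (saturatedConj Γ (g : GL (Fin 2) ℝ)).strictPeriods := by
    have h0 := hhper 0
    simp only [horocycle_eq, zero_add] at h0
    rw [surfaceProj_smul_eq_iff] at h0
    obtain ⟨M, hM, hM0⟩ := h0
    have h10 := hstab' M hM ⟨⟨0, t⟩, ht⟩ le_rfl (by rw [hM0]; exact le_rfl)
    obtain ⟨n, hn⟩ := hΔ.exists_smul_eq_zsmul_vadd hw hwper hM h10
    rw [hn] at hM0
    have hre : n * w = h := by simpa using congrArg UpperHalfPlane.re hM0
    rw [← hlen, ← hre, hwper, ← zsmul_eq_mul]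
    exact zsmul_mem (AddSubgroup.mem_zmultiples w) n
  rw [Set.eq_empty_iff_forall_notMem]
  rintro _ ⟨⟨s, rfl⟩, z, hz, hzs⟩
  simp only at hzs
  obtain ⟨γ, hγ, hγz⟩ := surfaceProj_eq_iff.1 hzs
  set G : GL (Fin 2) ℝ := (g : GL (Fin 2) ℝ) with hG
  have hproj (a : ℝ) : surfaceProj Γ (G • (G⁻¹ * γ) • β a) = surfaceProj Γ (β a) := by
    rw [mul_smul, smul_inv_smul]
    exact surfaceProj_eq_iff.2 ⟨γ, hγ, rfl⟩
  -- `γ` picks the lift through the point `z` of the horoball, and `G⁻¹` moves the cusp to `∞`.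
  refine (hΔ.im_lt_of_simple hw hwper ht hT hstab' (β := fun a => (G⁻¹ * γ) • β a)
    ((isometry_smul ℍ _).comp hβ) hl (fun a => ?_) ?_ s).not_ge ?_
  · rw [← surfaceProj_smul_eq_iff, hproj, hproj]
    exact hβper a
  · intro a b hab
    rw [← surfaceProj_smul_eq_iff, hproj, hproj] at hab
    exact hβper.exists_sub_eq_zsmul hl hβinj hab
  · rw [← mem_horoball_smul (g := g), ← hG, mul_smul, smul_inv_smul, hγz]
    exact hz

end

theorem mainTheorem2 (Γ : Subgroup (GL (Fin 2) ℝ)) (hΓ : IsSurfaceGroup Γ)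
    (c : OnePoint ℝ) (hc : IsCusp c Γ) :
    (∃ U : Set (HypSurface Γ), IsCuspRegion Γ c 2 U) ∧
    (∀ U : Set (HypSurface Γ), IsCuspRegion Γ c 2 U →
      ∀ C : Set (HypSurface Γ), IsSimpleClosedGeodesic Γ C → C ∩ U = ∅) :=
  ⟨exists_isCuspRegion_two hΓ hc, fun _ hU _ hC => hC.inter_eq_empty hΓ hc hU⟩
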